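/- Let $T$ be a complete first-order theory in a language $L$, and write $|T|=\aleph_0+|L|$. Assume that $T$ is NIP (does not have the independence property): there is no formula $\varphi(\bar x,\bar y)$ of $L$ such that for every $n<\omega$ $$T\vdash(\exists \bar y_0,\dots,\bar y_{n-1})\bigwedge_{\eta\in{}^n2}(\exists\bar x)\bigwedge_{\ell<n}\varphi(\bar x,\bar y_\ell)^{\eta(\ell)},$$ where $\varphi^{1}=\varphi$ and $\varphi^{0}=\neg\varphi$. A sequence $\langle\bar a_t:t\in I\rangle$ of finite tuples of one fixed length from a model of $T$, indexed by a linear order $I$, is called indiscernible if for all $n<\omega$ and all $t_0<\dots<t_{n-1}$ and $s_0<\dots<s_{n-1}$ in $I$ the tuples $\bar a_{t_0}{}^\frown\cdots{}^\frown\bar a_{t_{n-1}}$ and $\bar a_{s_0}{}^\frown\cdots{}^\frown\bar a_{s_{n-1}}$ satisfy the same formulas of $L$ (without parameters). Let $M$ be a model of $T$ (for example the monster model), let $\kappa>|T|$ be a cardinal, and for $\ell=1,2$ let $\bar{\mathbf a}^\ell=\langle\bar a^\ell_t:t\in I_\ell\rangle$ be an indiscernible sequence of $m_\ell$-tuples ($m_\ell<\omega$)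 from $M$, indexed by a linear order $I_\ell$ of cofinality $\kappa$. Then there are strictly increasing sequences $\langle s^\ell_i:i<\kappa\rangle$ of elements of $I_\ell$ ($\ell=1,2$) such that $\langle\bar a^1_{s^1_i}{}^\frown\bar a^2_{s^2_i}:i<\kappa\rangle$ is an indiscernible sequence. -/

import Mathlib

open FirstOrder Cardinal

universe u v w x

namespace NIPTheory

/-- The cardinality `|T|` of a first-order theory in the language `L`: the number of first-order
formulas of `L`, that is `ℵ₀ + |L|`. -/
noncomputable def theoryCard {L : FirstOrder.Language.{u, v}} (_T : L.Theory) : Cardinal.{max u v} :=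
  max ℵ₀ L.card

/-- For `φ(x̄, ȳ)` with `x̄` of length `p` and `ȳ` of length `q`, the sentence
`∃ ȳ₀ … ȳₙ₋₁, ⋀_{η : n → 2} ∃ x̄, ⋀_{l < n} φ(x̄, ȳ_l)^{η(l)}`, where `φ^{true} = φ` and
`φ^{false} = ¬φ`. -/
noncomputable def independenceSentence {L : FirstOrder.Language.{u, v}} {p q : ℕ} (φ : L.Formula (Fin p ⊕ Fin q)) (n : ℕ) :
    L.Sentence :=
  FirstOrder.Language.Formula.iExs (Fin n × Fin q)
    (FirstOrder.Language.Formula.iInf fun η : Fin n → Bool =>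
      FirstOrder.Language.Formula.iExs (Fin p)
        (FirstOrder.Language.Formula.iInf fun l : Fin n =>
          let φl : L.Formula ((Empty ⊕ (Fin n × Fin q)) ⊕ Fin p) :=
            φ.relabel (Sum.elim (fun i => Sum.inr i) (fun j => Sum.inl (Sum.inr (l, j))))
          if η l then φl else φl.not))

/-- The meaning of `independenceSentence φ n` in a structure. -/
theorem realize_independenceSentence {L : FirstOrder.Language.{u, v}} {M : Type w} [L.Structure M] {p q : ℕ}
    (φ : L.Formula (Fin p ⊕ Fin q)) (n : ℕ) :
    M ⊨ independenceSentence φ n ↔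
      ∃ b : Fin n → Fin q → M, ∀ η : Fin n → Bool, ∃ a : Fin p → M,
        ∀ l : Fin n, φ.Realize (Sum.elim a (b l)) ↔ η l = true := by
  have key : ∀ (b : Fin n × Fin q → M) (a : Fin p → M) (e : Empty → M) (l : Fin n),
      (Sum.elim (Sum.elim e b) a) ∘
        (Sum.elim (fun i => Sum.inr i) (fun j => Sum.inl (Sum.inr (l, j)))) =
      Sum.elim a (fun j => b (l, j)) := by
    intro b a e l
    funext k
    cases k <;> rfl
  simp only [independenceSentence, FirstOrder.Language.Sentence.Realize, FirstOrder.Language.Formula.realize_iExs,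
    FirstOrder.Language.Formula.realize_iInf]
  constructor
  · rintro ⟨b, hb⟩
    refine ⟨fun l j => b (l, j), fun η => ?_⟩
    obtain ⟨a, ha⟩ := hb η
    refine ⟨a, fun l => ?_⟩
    have h := ha l
    cases hη : η l <;>
      simp [hη, FirstOrder.Language.Formula.realize_not, FirstOrder.Language.Formula.realize_relabel, key] at h <;>
      simp [h]
  · rintro ⟨b, hb⟩
    refine ⟨fun k => b k.1 k.2, fun η => ?_⟩
    obtain ⟨a, ha⟩ := hb η
    refine ⟨a, fun l => ?_⟩
    have h := ha l
    cases hη : η l <;>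
      simp [hη, FirstOrder.Language.Formula.realize_not, FirstOrder.Language.Formula.realize_relabel, key] at h ⊢ <;>
      exact h

/-- A complete theory `T` has the independence property if for some formula `φ(x̄, ȳ)` and all `n`
the sentence `independenceSentence φ n` holds in the models of `T`. -/
def HasIP {L : FirstOrder.Language.{u, v}} (T : L.Theory) : Prop :=
  ∃ (p q : ℕ) (φ : L.Formula (Fin p ⊕ Fin q)), ∀ n : ℕ, T ⊨ᵇ independenceSentence φ n

/-- A complete theory is NIP if it does not have the independence property. -/
def IsNIP {L : FirstOrder.Language.{u, v}} (T : L.Theory) : Prop :=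
  ¬ HasIP T

/-- A sequence `⟨ā_t : t ∈ I⟩` of `m`-tuples of `M` is indiscernible if, for all `n` and all
`t₀ < ⋯ < tₙ₋₁` and `s₀ < ⋯ < sₙ₋₁` in `I`, the tuples `ā_{t₀} ⌢ ⋯ ⌢ ā_{tₙ₋₁}` and
`ā_{s₀} ⌢ ⋯ ⌢ ā_{sₙ₋₁}` realize the same complete type over `∅`. -/
def Indiscernible (L : FirstOrder.Language.{u, v}) {M : Type w} [L.Structure M] {I : Type x} [LinearOrder I]
    {m : ℕ} (a : I → Fin m → M) : Prop :=
  ∀ (n : ℕ) (φ : L.Formula (Fin n × Fin m)) (t s : Fin n → I), StrictMono t → StrictMono s →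
    (φ.Realize (fun k => a (t k.1) k.2) ↔ φ.Realize (fun k => a (s k.1) k.2))

end NIPTheory

/-! By NIP a formula with parameters cannot alternate forever along an indiscernible sequence
without last element, so its truth value is eventually constant: the sequence has an average type
over `M`. This iterates. Let `G` be the filter "for all large `y₁`, for all large `y₂`" on pairs of
indices; then each formula in `n` successive `G`-generic pairs is generically true or generically
false.

Since both cofinalities are `κ`, the filter `G` is closed under fewer than `κ` intersections. There
are fewer than `κ` formulas over fewer than `κ` earlier pairs, so a recursion of length `κ` can
choose each pair generic over its predecessors, inside `M` and without saturation. Every increasing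
`n`-tuple then has the generic truth values, which gives indiscernibility; being strictly increasing
is one more generic property. -/

open FirstOrder.Language Filter

namespace NIPTheory

/-! ### Alternation and the independence property -/

section Alternation

variable {L : FirstOrder.Language.{u, v}} {M : Type w} [L.Structure M]

/-- Only finitely many of the parameter variables of a formula matter. -/
theorem exists_fin_parameters {q : ℕ} {γ : Type*} (ψ : L.Formula (Fin q ⊕ γ)) :
    ∃ (p : ℕ) (φ : L.Formula (Fin p ⊕ Fin q)) (e : Fin p → γ), ∀ (y : Fin q → M) (g : γ → M),
      φ.Realize (Sum.elim (g ∘ e) y) ↔ ψ.Realize (Sum.elim y g) := by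
  classical
  let s : Finset γ := (BoundedFormula.freeVarFinset ψ).toRight
  let f : BoundedFormula.freeVarFinset ψ → Fin s.card ⊕ Fin q := fun k =>
    match k with
    | ⟨Sum.inl b, _⟩ => Sum.inr b
    | ⟨Sum.inr c, h⟩ => Sum.inl (s.equivFin ⟨c, Finset.mem_toRight.2 h⟩)
  refine ⟨s.card, BoundedFormula.restrictFreeVar ψ f, fun k => (s.equivFin.symm k : γ),
    fun y g => ?_⟩
  refine BoundedFormula.realize_restrictFreeVar _ ?_
  rintro ⟨b | c, h⟩ <;> simp [f]

/-- A formula that alternates arbitrarily often along an indiscernible sequence witnesses the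
independence property. -/
theorem hasIP_of_alternates {T : L.Theory} (hT : T.IsComplete) [Nonempty M] [M ⊨ T]
    {I : Type*} [LinearOrder I] {q : ℕ} {a : I → Fin q → M} (ha : Indiscernible L a)
    {γ : Type*} (ψ : L.Formula (Fin q ⊕ γ)) {t : ℕ → I} (ht : StrictMono t)
    (h : ∀ N : ℕ, ∃ g : γ → M, ∀ l < N, ψ.Realize (Sum.elim (a (t l)) g) ↔ Even l) :
    HasIP T := by
  obtain ⟨p, φ, e, hφ⟩ := exists_fin_parameters (M := M) ψ
  refine ⟨p, q, φ, fun n => ?_⟩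
  rw [← hT.realize_sentence_iff _ M, realize_independenceSentence]
  refine ⟨fun l => a (t l), fun η => ?_⟩
  -- Solvability of the pattern `η` is a formula in the sequence elements alone, so indiscernibility
  -- moves it from one increasing tuple to another.
  let χ : L.Formula (Fin n × Fin q) :=
    Formula.iExs (Fin p) (Formula.iInf fun l : Fin n =>
      let φl : L.Formula ((Fin n × Fin q) ⊕ Fin p) :=
        φ.relabel (Sum.elim (fun i => Sum.inr i) (fun j => Sum.inl (l, j)))
      if η l then φl else φl.not)
  have hχ : ∀ r : Fin n → I, χ.Realize (fun k => a (r k.1) k.2) ↔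
      ∃ x : Fin p → M, ∀ l, φ.Realize (Sum.elim x (a (r l))) ↔ η l = true := by
    intro r
    simp only [χ, Formula.realize_iExs, Formula.realize_iInf]
    refine exists_congr fun x => forall_congr' fun l => ?_
    have key : Sum.elim (fun k : Fin n × Fin q => a (r k.1) k.2) x ∘
        Sum.elim (fun i => Sum.inr i) (fun j => Sum.inl (l, j)) = Sum.elim x (a (r l)) := by
      funext k
      cases k <;> rfl
    cases η l <;> simp [Formula.realize_not, Formula.realize_relabel, key]
  -- From each block `{2l, 2l+1}` take the index whose parity gives the truth value `η l`.
  let r : Fin n → ℕ := fun l => 2 * (l : ℕ) + if η l then 0 else 1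
  have hr : StrictMono r := by
    intro i j hij
    have : (i : ℕ) < j := hij
    simp only [r]
    split_ifs <;> omega
  refine (hχ _).1 ((ha n χ (fun l => t l) (t ∘ r)
    (fun i j hij => ht hij) (ht.comp hr)).2 ((hχ _).2 ?_))
  obtain ⟨g, hg⟩ := h (2 * n)
  refine ⟨g ∘ e, fun l => ?_⟩
  have hl : r l < 2 * n := by
    have := l.2
    simp only [r]
    split_ifs <;> omega
  rw [hφ, Function.comp_apply, hg _ hl]
  cases hη : η l <;> simp [r, hη]

end Alternation

theorem exists_alternating {I : Type*} [LinearOrder I] [NoMaxOrder I] [Nonempty I] {X : I → Prop}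
    (h₁ : ∃ᶠ i in atTop, X i) (h₂ : ∃ᶠ i in atTop, ¬ X i) :
    ∃ t : ℕ → I, StrictMono t ∧ ∀ l, X (t l) ↔ Even l := by
  have step : ∀ (i : I) (l : ℕ), ∃ j, i < j ∧ (X j ↔ Even l) := by
    intro i l
    by_cases hl : Even l
    · obtain ⟨j, hj, hij⟩ := (h₁.and_eventually (eventually_gt_atTop i)).exists
      exact ⟨j, hij, iff_of_true hj hl⟩
    · obtain ⟨j, hj, hij⟩ := (h₂.and_eventually (eventually_gt_atTop i)).exists
      exact ⟨j, hij, iff_of_false hj hl⟩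
  choose f hf hX using step
  let t : ℕ → I := fun n => Nat.rec (f (Classical.arbitrary I) 0) (fun n i => f i (n + 1)) n
  refine ⟨t, strictMono_nat_of_lt_succ fun n => hf _ _, fun l => ?_⟩
  cases l with
  | zero => exact hX _ _
  | succ n => exact hX _ _

/-! ### Average types and their iteration -/

section Decides

variable (L : FirstOrder.Language.{u, v}) {M : Type w} [L.Structure M]

/-- Along the filter `H`, the tuples `c j` eventually decide every formula with parameters
from `M`; that is, they have an average type over `M`. -/
def Decides {J α : Type*} (H : Filter J) (c : J → α → M) : Prop :=
  ∀ ψ : L.Formula (α ⊕ M),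
    (∀ᶠ j in H, ψ.Realize (Sum.elim (c j) id)) ∨ ∀ᶠ j in H, ¬ ψ.Realize (Sum.elim (c j) id)

variable {L}

theorem decides_pure {J α : Type*} (j : J) (c : J → α → M) : Decides L (pure j) c := by
  intro ψ
  simpa using em _

theorem Decides.eventually_or {J α β : Type*} {H : Filter J} {c : J → α → M} (h : Decides L H c)
    (ψ : L.Formula β) (e : β → α ⊕ M) :
    (∀ᶠ j in H, ψ.Realize (Sum.elim (c j) id ∘ e)) ∨
      ∀ᶠ j in H, ¬ ψ.Realize (Sum.elim (c j) id ∘ e) := by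
  simpa only [Formula.realize_relabel] using h (ψ.relabel e)

theorem Decides.comp {J α β : Type*} {H : Filter J} {c : J → α → M} (h : Decides L H c)
    (e : β → α) : Decides L H (fun j => c j ∘ e) := by
  intro ψ
  simpa only [Sum.elim_comp_map, Function.id_comp, Function.comp_id]
    using h.eventually_or ψ (Sum.map e id)

/-- In a NIP theory an indiscernible sequence without last element has an average type, also over
parameters that themselves realize an average type. -/
theorem Decides.curry {T : L.Theory} (hT : T.IsComplete) (hNIP : IsNIP T) [Nonempty M] [M ⊨ T]
    {I : Type*} [LinearOrder I] [NoMaxOrder I] [Nonempty I] {q : ℕ} {a : I → Fin q → M}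
    (ha : Indiscernible L a) {J α : Type*} {H : Filter J} [H.NeBot] {c : J → α → M}
    (h : Decides L H c) :
    Decides L ((atTop : Filter I).curry H)
      (fun k : I × J => (Sum.elim (a k.1) (c k.2) : Fin q ⊕ α → M)) := by
  intro ψ
  simp only [eventually_curry_iff]
  have dec : ∀ i, (∀ᶠ j in H, ψ.Realize (Sum.elim (Sum.elim (a i) (c j)) id)) ∨
      ∀ᶠ j in H, ¬ ψ.Realize (Sum.elim (Sum.elim (a i) (c j)) id) := by
    intro i
    have key := h.eventually_or ψ
      (Sum.elim (Sum.elim (fun x => Sum.inr (a i x)) Sum.inl) Sum.inr)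
    have e : ∀ j, (Sum.elim (c j) id ∘
        (Sum.elim (Sum.elim (fun x => Sum.inr (a i x)) Sum.inl) Sum.inr :
          (Fin q ⊕ α) ⊕ M → α ⊕ M)) = Sum.elim (Sum.elim (a i) (c j)) id := by
      intro j
      funext k
      rcases k with (k | k) | k <;> rfl
    simpa only [e] using key
  by_contra hcon
  rw [not_or] at hcon
  have hX : ∃ᶠ i in atTop, ∀ᶠ j in H, ψ.Realize (Sum.elim (Sum.elim (a i) (c j)) id) := by
    refine (not_eventually.1 hcon.2).mono fun i hi => (dec i).resolve_right hi
  obtain ⟨t, ht, hpat⟩ := exists_alternating hX (not_eventually.1 hcon.1)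
  let ψ' : L.Formula (Fin q ⊕ (α ⊕ M)) := ψ.relabel (Equiv.sumAssoc (Fin q) α M)
  have hψ' : ∀ i j, ψ'.Realize (Sum.elim (a i) (Sum.elim (c j) id)) ↔
      ψ.Realize (Sum.elim (Sum.elim (a i) (c j)) id) := by
    intro i j
    simp only [ψ', Formula.realize_relabel]
    have e : (Sum.elim (a i) (Sum.elim (c j) id) ∘ Equiv.sumAssoc (Fin q) α M) =
        Sum.elim (Sum.elim (a i) (c j)) id := by
      funext k
      rcases k with (k | k) | k <;> rfl
    rw [e]
  refine hNIP (hasIP_of_alternates (M := M) hT ha ψ' ht fun N => ?_)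
  -- Each of the first `N` alternations holds for generic `j`, so a single `j` serves them all.
  have hj : ∀ᶠ j in H, ∀ l ∈ Finset.range N,
      (ψ'.Realize (Sum.elim (a (t l)) (Sum.elim (c j) id)) ↔ Even l) := by
    rw [eventually_all_finset]
    intro l _
    by_cases hl : Even l
    · filter_upwards [(hpat l).2 hl] with j hj
      exact iff_of_true ((hψ' _ _).2 hj) hl
    · filter_upwards [(dec (t l)).resolve_left fun h' => hl ((hpat l).1 h')] with j hj
      exact iff_of_false (fun h' => hj ((hψ' _ _).1 h')) hl
  obtain ⟨j, hj⟩ := hj.exists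
  exact ⟨Sum.elim (c j) id, fun l hl => hj l (Finset.mem_range.2 hl)⟩

end Decides

/-! ### Complete filters and generic sequences -/

section Generic

/-- The filter of sets of lists `[z₀, …, zₙ₋₁]` such that `z₀` is `G`-generic, `z₁` is `G`-generic
depending on `z₀`, and so on. -/
def listFilter {Z : Type*} (G : Filter Z) : ℕ → Filter (List Z)
  | 0 => pure []
  | n + 1 => (G.curry (listFilter G n)).map fun k => k.1 :: k.2

theorem eventually_listFilter_zero {Z : Type*} {G : Filter Z} {P : List Z → Prop} :
    (∀ᶠ l in listFilter G 0, P l) ↔ P [] := Iff.rfl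

theorem eventually_listFilter_succ {Z : Type*} {G : Filter Z} {n : ℕ} {P : List Z → Prop} :
    (∀ᶠ l in listFilter G (n + 1), P l) ↔ ∀ᶠ z in G, ∀ᶠ l in listFilter G n, P (z :: l) := Iff.rfl

theorem neBot_curry {A B : Type*} {F : Filter A} {G : Filter B} [F.NeBot] [G.NeBot] :
    (F.curry G).NeBot := by
  refine ⟨fun h => ?_⟩
  have h' : ∀ᶠ k in F.curry G, False := by simp [h]
  obtain ⟨_, hx⟩ := (eventually_curry_iff.1 h').exists
  exact hx.exists.elim fun _ => id

theorem listFilter_neBot {Z : Type*} {G : Filter Z} [G.NeBot] (n : ℕ) :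
    (listFilter G n).NeBot := by
  induction n with
  | zero => exact pure_neBot
  | succ n ih => exact neBot_curry.map _

/-- `G` is closed under intersections of fewer than `κ` sets indexed by a type in universe `y`. -/
def IsCompleteFilter.{y, z, x'} (κ : Cardinal.{x'}) {Z : Type z} (G : Filter Z) : Prop :=
  ∀ (ι : Type y) (p : ι → Z → Prop), lift.{x'} #ι < lift.{y} κ →
    (∀ i, ∀ᶠ z in G, p i z) → ∀ᶠ z in G, ∀ i, p i z

theorem nonempty_and_noMaxOrder {I : Type x} [LinearOrder I] (h : ℵ₀ ≤ Order.cof I) :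
    Nonempty I ∧ NoMaxOrder I := by
  have hne : Nonempty I := by
    by_contra hI
    rw [not_nonempty_iff] at hI
    rw [Order.cof_eq_zero] at h
    exact absurd h aleph0_pos.not_ge
  refine ⟨hne, ⟨fun i => ?_⟩⟩
  by_contra! hi
  exact absurd (h.trans (Order.cof_le_one_iff.2 ⟨i, hi⟩)) one_lt_aleph0.not_ge

/-- Fewer than `κ` thresholds are not cofinal, so one element lies above them all. -/
theorem isCompleteFilter_atTop {I : Type x} [LinearOrder I] {κ : Cardinal.{x}}
    (hI : Order.cof I = κ) : IsCompleteFilter.{max u x} κ (atTop : Filter I) := by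
  intro ι p hι hp
  rcases isEmpty_or_nonempty I with hI' | hI'
  · rw [Filter.filter_eq_bot_of_isEmpty atTop]
    exact eventually_bot
  have hp' : ∀ i, ∃ b, ∀ z ≥ b, p i z := fun i => eventually_atTop.1 (hp i)
  choose b hb using hp'
  have hb' : ¬ IsCofinal (Set.range b) := by
    intro h
    have h₁ := Cardinal.lift_le.{max u x}.2 (Order.cof_le h)
    rw [hI] at h₁
    have h₂ := mk_range_le_lift (f := b)
    exact absurd ((h₁.trans h₂).trans_lt hι) (lt_irrefl _)
  obtain ⟨z, hz⟩ := not_isCofinal_iff.1 hb'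
  filter_upwards [eventually_ge_atTop z] with y hy i
  exact hb i y ((hz _ ⟨i, rfl⟩).le.trans hy)

theorem IsCompleteFilter.curry {A B : Type*} {κ : Cardinal.{x}} {F : Filter A} {G : Filter B}
    (hF : IsCompleteFilter.{u} κ F) (hG : IsCompleteFilter.{u} κ G) :
    IsCompleteFilter.{u} κ (F.curry G) := by
  intro ι p hι hp
  simp only [eventually_curry_iff] at hp ⊢
  exact (hF ι _ hι hp).mono fun i hi => hG ι _ hι hi

/-- For a sufficiently complete filter `G` there is a sequence of length `κ` all of whose finite
increasing subsequences have the given, fewer than `κ`, generic properties. -/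
theorem exists_generic_sequence {Z : Type*} {G : Filter Z} [G.NeBot] {κ : Cardinal.{x}}
    (hκ : ℵ₀ < κ) (hG : IsCompleteFilter.{max u x} κ G) {Φ : Type u} (P : Φ → List Z → Prop)
    (hΦ : lift.{x} #Φ < lift.{u} κ) :
    ∃ s : κ.ord.ToType → Z, ∀ (n : ℕ) (φ : Φ), (∀ᶠ l in listFilter G n, P φ l) →
      ∀ l : List κ.ord.ToType, l.Pairwise (· < ·) → l.length = n → P φ (l.map s) := by
  -- `z` is good if it can replace the first generic entry after any finite list of earlier terms
  -- without losing a generic property. This is fewer than `κ` conditions, each `G`-generic.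
  let good (i : κ.ord.ToType) (s : Set.Iio i → Z) (z : Z) : Prop :=
    ∀ k : Φ × ℕ × List (Set.Iio i),
      (∀ᶠ l in listFilter G (k.2.1 + 1), P k.1 (k.2.2.map s ++ l)) →
        ∀ᶠ l in listFilter G k.2.1, P k.1 (k.2.2.map s ++ z :: l)
  have hgood : ∀ i s, ∃ z, good i s z := by
    intro i s
    refine (hG (Φ × ℕ × List (Set.Iio i)) _ ?_ fun k => ?_).exists
    · have hκ' : ℵ₀ < lift.{u} κ := by simpa using hκ
      have h₁ : lift.{u} #(List (Set.Iio i)) < lift.{u} κ :=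
        lift_lt.2 ((mk_list_le_max _).trans_lt
          (max_lt hκ (by simpa using mk_Iio_lt i (by simp))))
      have h₂ := mul_lt_of_lt hκ'.le hΦ (mul_lt_of_lt hκ'.le hκ' h₁)
      simpa [mk_prod] using lift_lt.{_, x}.2 h₂
    · by_cases h : ∀ᶠ l in listFilter G (k.2.1 + 1), P k.1 (k.2.2.map s ++ l)
      · exact (eventually_listFilter_succ.1 h).mono fun z hz _ => hz
      · exact Eventually.of_forall fun z h' => absurd h' h
  choose next hnext using hgood
  let s : κ.ord.ToType → Z :=
    wellFounded_lt.fix fun i ih => next i fun j => ih j.1 j.2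
  have hs : ∀ i, s i = next i fun j => s j.1 := fun i => wellFounded_lt.fix_eq _ i
  -- Strengthened for induction: `l₁` is already realized, and the generic tail is replaced by `l₂`
  -- one entry at a time.
  have main : ∀ (φ : Φ) (l₂ l₁ : List κ.ord.ToType), (l₁ ++ l₂).Pairwise (· < ·) →
      (∀ᶠ l in listFilter G l₂.length, P φ (l₁.map s ++ l)) → P φ ((l₁ ++ l₂).map s) := by
    intro φ l₂
    induction l₂ with
    | nil =>
      intro l₁ _ h
      simpa using eventually_listFilter_zero.1 h
    | cons i l₂ ih =>
      intro l₁ hl h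
      have hlt : ∀ j ∈ l₁, j < i := fun j hj =>
        (List.pairwise_append.1 hl).2.2 j hj i List.mem_cons_self
      have e : (l₁.attach.map fun j => (⟨j.1, hlt j.1 j.2⟩ : Set.Iio i)).map (fun j => s j.1) =
          l₁.map s := by
        simp [List.map_map, Function.comp_def]
      have key := hnext i (fun j => s j.1)
        (φ, l₂.length, l₁.attach.map fun j => (⟨j.1, hlt j.1 j.2⟩ : Set.Iio i))
      simp only [e] at key
      rw [← hs i] at key
      have := ih (l₁ ++ [i]) (by simpa using hl) (by simpa using key h)
      simpa using this
  refine ⟨s, fun n φ h l hl hn => main φ l [] hl ?_⟩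
  subst hn
  simpa using h

end Generic

theorem mk_formula_le {L : FirstOrder.Language.{u, v}} (m : ℕ) :
    #(L.Formula (ℕ × Fin m)) ≤ max ℵ₀ L.card := by
  have h₁ : #(L.Formula (ℕ × Fin m)) ≤ #(Σ n, L.BoundedFormula (ℕ × Fin m) n) :=
    mk_le_of_injective (f := fun φ => ⟨0, φ⟩) fun φ ψ h => by simpa using h
  have h₂ : lift.{max u v} #(ℕ × Fin m) ≤ max ℵ₀ L.card :=
    le_max_of_le_left (lift_le_aleph0.2 mk_le_aleph0)
  refine (h₁.trans BoundedFormula.card_le).trans (max_le (le_max_left _ _) ?_)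
  refine add_le_of_le (le_max_left _ _) h₂ ?_
  simp

/-! ### Generic lists of pairs -/

section Pairs

variable {L : FirstOrder.Language.{u, v}} {M : Type w} [L.Structure M]

theorem Decides.listFilter {T : L.Theory} (hT : T.IsComplete) (hNIP : IsNIP T) [Nonempty M]
    [M ⊨ T] {I₁ I₂ : Type*} [LinearOrder I₁] [LinearOrder I₂] [NoMaxOrder I₁] [NoMaxOrder I₂]
    [Nonempty I₁] [Nonempty I₂] {m₁ m₂ : ℕ} {a₁ : I₁ → Fin m₁ → M} {a₂ : I₂ → Fin m₂ → M}
    (ha₁ : Indiscernible L a₁) (ha₂ : Indiscernible L a₂) (z₀ : I₁ × I₂) (n : ℕ) :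
    Decides L (listFilter ((atTop : Filter I₁).curry (atTop : Filter I₂)) n)
      (fun l (k : ℕ × Fin (m₁ + m₂)) =>
        Fin.append (a₁ (l.getD k.1 z₀).1) (a₂ (l.getD k.1 z₀).2) k.2) := by
  induction n with
  | zero => exact decides_pure _ _
  | succ n ih =>
    have := neBot_curry (F := (atTop : Filter I₁)) (G := (atTop : Filter I₂))
    have := listFilter_neBot (G := (atTop : Filter I₁).curry (atTop : Filter I₂)) n
    have := neBot_curry (F := (atTop : Filter I₂))
      (G := NIPTheory.listFilter ((atTop : Filter I₁).curry (atTop : Filter I₂)) n)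
    let e : ℕ × Fin (m₁ + m₂) → Fin m₁ ⊕ (Fin m₂ ⊕ (ℕ × Fin (m₁ + m₂))) := fun k =>
      match k with
      | (0, x) => Fin.addCases (motive := fun _ => Fin m₁ ⊕ (Fin m₂ ⊕ (ℕ × Fin (m₁ + m₂))))
          Sum.inl (fun y => Sum.inr (Sum.inl y)) x
      | (i + 1, x) => Sum.inr (Sum.inr (i, x))
    have he : ∀ (y₁ : I₁) (y₂ : I₂) (l : List (I₁ × I₂)),
        (fun k : ℕ × Fin (m₁ + m₂) => Fin.append (a₁ (((y₁, y₂) :: l).getD k.1 z₀).1)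
          (a₂ (((y₁, y₂) :: l).getD k.1 z₀).2) k.2) =
        Sum.elim (a₁ y₁) (Sum.elim (a₂ y₂) fun k : ℕ × Fin (m₁ + m₂) =>
          Fin.append (a₁ (l.getD k.1 z₀).1) (a₂ (l.getD k.1 z₀).2) k.2) ∘ e := by
      intro y₁ y₂ l
      funext ⟨i, x⟩
      cases i with
      | zero => refine Fin.addCases (fun x => ?_) (fun x => ?_) x <;> simp [e]
      | succ i => simp [e]
    intro ψ
    -- The tail of the list is decided, so `Decides.curry` adds the second and then the first
    -- component of the head pair.
    have hψ := ((ih.curry hT hNIP ha₂).curry hT hNIP ha₁).comp e ψ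
    simp only [eventually_curry_iff] at hψ
    simpa only [eventually_listFilter_succ, eventually_curry_iff, he] using hψ

end Pairs

end NIPTheory

/-! ### The theorem -/

open NIPTheory Filter in
theorem claim3 {L : FirstOrder.Language.{u, v}} (T : L.Theory) (hT : T.IsComplete)
    (hNIP : NIPTheory.IsNIP T)
    (M : Type w) [L.Structure M] [Nonempty M] [M ⊨ T]
    (κ : Cardinal.{x})
    (hκ : Cardinal.lift.{x} (NIPTheory.theoryCard T) < Cardinal.lift.{max u v} κ)
    (I₁ I₂ : Type x) [LinearOrder I₁] [LinearOrder I₂]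
    (hI₁ : Order.cof I₁ = κ) (hI₂ : Order.cof I₂ = κ)
    (m₁ m₂ : ℕ) (a₁ : I₁ → Fin m₁ → M) (a₂ : I₂ → Fin m₂ → M)
    (ha₁ : NIPTheory.Indiscernible L a₁) (ha₂ : NIPTheory.Indiscernible L a₂) :
    ∃ (s₁ : κ.ord.ToType → I₁) (s₂ : κ.ord.ToType → I₂),
      StrictMono s₁ ∧ StrictMono s₂ ∧
      NIPTheory.Indiscernible L (fun i => Fin.append (a₁ (s₁ i)) (a₂ (s₂ i))) := by
  have hκ₀ : ℵ₀ < κ := by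
    have h : lift.{x} ℵ₀ < lift.{max u v} κ :=
      (lift_le.2 (le_max_left _ _)).trans_lt hκ
    simpa using h
  obtain ⟨_, _⟩ := nonempty_and_noMaxOrder (I := I₁) (hI₁ ▸ hκ₀.le)
  obtain ⟨_, _⟩ := nonempty_and_noMaxOrder (I := I₂) (hI₂ ▸ hκ₀.le)
  -- A dummy value for variables beyond the end of the list, so that one formula type serves every
  -- `n`.
  let z₀ : I₁ × I₂ := Classical.arbitrary _
  let val (l : List (I₁ × I₂)) (k : ℕ × Fin (m₁ + m₂)) : M :=
    Fin.append (a₁ (l.getD k.1 z₀).1) (a₂ (l.getD k.1 z₀).2) k.2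
  -- `none` carries the monotonicity condition, so the same recursion secures it along with the
  -- formulas.
  let P : Option (L.Formula (ℕ × Fin (m₁ + m₂))) → List (I₁ × I₂) → Prop := fun o l =>
    match o with
    | none => l.Pairwise fun y z => y.1 < z.1 ∧ y.2 < z.2
    | some φ => φ.Realize (val l)
  have := neBot_curry (F := (atTop : Filter I₁)) (G := (atTop : Filter I₂))
  obtain ⟨s, hs⟩ := exists_generic_sequence hκ₀
    ((isCompleteFilter_atTop.{max u v} hI₁).curry (isCompleteFilter_atTop hI₂)) P
    (by
      have h : #(Option (L.Formula (ℕ × Fin (m₁ + m₂)))) ≤ theoryCard T := by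
        rw [mk_option]
        exact add_le_of_le (le_max_left _ _) (mk_formula_le _)
          (one_le_aleph0.trans (le_max_left _ _))
      exact (lift_le.2 h).trans_lt hκ)
  have hlt : ∀ i j, i < j → (s i).1 < (s j).1 ∧ (s i).2 < (s j).2 := by
    intro i j hij
    have h := hs 2 none (by
      simp only [eventually_listFilter_succ, eventually_listFilter_zero, eventually_curry_iff, P]
      refine Eventually.of_forall fun y₁ => Eventually.of_forall fun y₂ => ?_
      filter_upwards [eventually_gt_atTop y₁] with z₁ h₁
      filter_upwards [eventually_gt_atTop y₂] with z₂ h₂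
      simp [h₁, h₂]) [i, j] (by simpa using hij) rfl
    simpa [P] using h
  refine ⟨fun i => (s i).1, fun i => (s i).2, fun i j hij => (hlt i j hij).1,
    fun i j hij => (hlt i j hij).2, fun n φ t r ht hr => ?_⟩
  let φ' : L.Formula (ℕ × Fin (m₁ + m₂)) := φ.relabel (Prod.map Fin.val id)
  have hφ' : ∀ t : Fin n → κ.ord.ToType, φ'.Realize (val ((List.ofFn t).map s)) ↔
      φ.Realize fun k => Fin.append (a₁ (s (t k.1)).1) (a₂ (s (t k.1)).2) k.2 := by
    intro t
    simp only [φ', FirstOrder.Language.Formula.realize_relabel]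
    have e : val ((List.ofFn t).map s) ∘ Prod.map Fin.val id =
        fun k => Fin.append (a₁ (s (t k.1)).1) (a₂ (s (t k.1)).2) k.2 := by
      funext k
      simp [val]
    rw [e]
  have hsorted : ∀ t : Fin n → κ.ord.ToType, StrictMono t →
      (List.ofFn t).Pairwise (· < ·) := fun t ht => List.pairwise_ofFn.2 fun _ _ h => ht h
  rw [← hφ' t, ← hφ' r]
  rcases Decides.eventually_or (Decides.listFilter hT hNIP ha₁ ha₂ z₀ n) φ' Sum.inl with h | h
  · exact iff_of_true (hs n (some φ') h _ (hsorted t ht) (by simp))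
      (hs n (some φ') h _ (hsorted r hr) (by simp))
  · exact iff_of_false (hs n (some φ'.not) h _ (hsorted t ht) (by simp))
      (hs n (some φ'.not) h _ (hsorted r hr) (by simp))
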